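/- Let $N\ge 3$ be an integer, let $p_0,p_1,p_2,p_3\in[0,1]$, and put $q_m:=1-p_m$. On $\Sigma=\{0,1\}^N$, with indices read modulo $N$, write $m_i(x):=2x_{i-1}+x_{i+1}$ and let $x^i$ be $x$ with its $i$th component replaced by $1-x_i$. The Markov chain in $\Sigma$ with parameter vector $(p_0,p_1,p_2,p_3)$ has one-step transition matrix $$P(x,x^i)=N^{-1}p_{m_i(x)}\ \text{ if }x_i=0,\qquad P(x,x^i)=N^{-1}q_{m_i(x)}\ \text{ if }x_i=1,\qquad i=1,\dots,N,$$ $$P(x,x)=N^{-1}\Big(\sum_{i:x_i=0}q_{m_i(x)}+\sum_{i:x_i=1}p_{m_i(x)}\Big),$$ and $P(x,y)=0$ otherwise. It is called ergodic if it has a unique stationary distribution and, for every initial distribution, the distribution at time $n$ converges to it as $n\to\infty$. Let $(X(n),I(n))_{n\ge0}$ be a Markov chain in $\Sigma\times\{1,\dots,N\}$ that moves from $(x,i)$, for each $j=1,\dots,N$, to $(x^i,j)$ with probability $N^{-1}p_{m_i(x)}$ if $x_i=0$ and $N^{-1}q_{m_i(x)}$ if $x_i=1$, and to $(x,j)$ with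 probability $N^{-1}q_{m_i(x)}$ if $x_i=0$ and $N^{-1}p_{m_i(x)}$ if $x_i=1$. Let $S_n:=\xi_1+\cdots+\xi_n$, where $\xi_k:=1$ (a win) if the component of $X(k)$ with index $I(k-1)$ is $1$, and $\xi_k:=-1$ (a loss) otherwise. Let $\mu^N(p_0,p_1,p_2,p_3)$ denote the constant, when it exists, such that $n^{-1}S_n\to\mu^N(p_0,p_1,p_2,p_3)$ almost surely for every initial distribution. Assume that the Markov chain with parameter vector $(p_0,p_1,p_2,p_3)$ is ergodic. Then $\mu^N(p_0,p_1,p_2,p_3)$ exists, and the following hold. (a) The Markov chain with parameter vector $(q_3,q_2,q_1,q_0)$ is ergodic, $\mu^N(q_3,q_2,q_1,q_0)$ exists, and $$\mu^N(p_0,p_1,p_2,p_3)=-\mu^N(q_3,q_2,q_1,q_0).$$ In particular, if $p_0+p_3=1$ and $p_1+p_2=1$, then $\mu^N(p_0,p_1,p_2,p_3)=0$. (b) $$2\min(p_0,p_1,p_2,p_3)-1\le\mu^N(p_0,p_1,p_2,p_3)\le2\max(p_0,p_1,p_2,p_3)-1.$$ -/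

import Mathlib

open Filter Topology MeasureTheory
open scoped Matrix

noncomputable section

namespace CoopParrondo

section FiniteChains

variable {S : Type*} [Fintype S]

/-- `π` is a stationary distribution of the transition matrix `P`
(probability distributions are row vectors). -/
def IsStationary (P : Matrix S S ℝ) (π : S → ℝ) : Prop :=
  π ∈ stdSimplex ℝ S ∧ π ᵥ* P = π

/-- The finite Markov chain with transition matrix `P` is ergodic: there is a unique stationary
distribution, and the distribution at time `n` converges to it as `n → ∞`, whatever the initial
distribution `ν`. -/
def IsErgodic [DecidableEq S] (P : Matrix S S ℝ) : Prop :=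
  ∃ π : S → ℝ, IsStationary P π ∧ (∀ π', IsStationary P π' → π' = π) ∧
    ∀ ν ∈ stdSimplex ℝ S, Tendsto (fun n : ℕ => ν ᵥ* P ^ n) atTop (𝓝 π)

end FiniteChains

/-- Status of each of the `N` players, `0` = loser and `1` = winner. The players sit in a circle and
are labelled by `Fin N`, whose addition is modulo `N`. -/
abbrev State (N : ℕ) : Type := Fin N → Fin 2

section Model

variable (N : ℕ) [NeZero N] (p : Fin 4 → ℝ)

variable {N} in
/-- `m_i(x) = 2 x_{i-1} + x_{i+1}`, with indices modulo `N`. -/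
def nbr (x : State N) (i : Fin N) : Fin 4 :=
  ⟨2 * (x (i - 1)).val + (x (i + 1)).val, by omega⟩

variable {N} in
/-- The state `x^i`: `x` with the `i`th component flipped. -/
def flip (x : State N) (i : Fin N) : State N :=
  Function.update x i (1 - x i)

variable {N} in
/-- Probability that player `i`, when he plays in state `x`, changes his status: he wins with
probability `p_{m_i(x)}` and loses with probability `q_{m_i(x)} = 1 - p_{m_i(x)}`. -/
def changeProb (x : State N) (i : Fin N) : ℝ :=
  if x i = 0 then p (nbr x i) else 1 - p (nbr x i)

variable {N} in
/-- Probability that player `i`, when he plays in state `x`, keeps his status. -/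
def keepProb (x : State N) (i : Fin N) : ℝ :=
  if x i = 0 then 1 - p (nbr x i) else p (nbr x i)

/-- The one-step transition matrix of the chain with parameter vector `p` on `{0,1}^N`.
The states `x^i` are distinct from each other and from `x`, so at most one summand in the last line
is nonzero. -/
def transition : Matrix (State N) (State N) ℝ := fun x y =>
  if y = x then (N : ℝ)⁻¹ * ∑ i, keepProb p x i
  else ∑ i, if y = flip x i then (N : ℝ)⁻¹ * changeProb p x i else 0

/-- The one-step transition matrix of the chain on `{0,1}^N × {players}`, whose state `(x, i)`
records the statuses and the next player to play. -/
def transitionStar : Matrix (State N × Fin N) (State N × Fin N) ℝ := fun a b =>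
  if b.1 = flip a.1 a.2 then (N : ℝ)⁻¹ * changeProb p a.1 a.2
  else if b.1 = a.1 then (N : ℝ)⁻¹ * keepProb p a.1 a.2
  else 0

variable {N} in
/-- Payoff of a transition `(x, i) → (y, j)`: `1` if player `i` won and `-1` if he lost. He won
precisely when his new status is that of a winner, `y_i = 1`. -/
def payoff (a b : State N × Fin N) : ℝ :=
  if b.1 a.2 = 1 then 1 else -1

/-- `Z = (X, I)` is a Markov chain, with an arbitrary initial distribution, with transition matrix
`transitionStar N p` under the probability measure `ℙ`. -/
structure IsGameChain {Ω : Type*} [MeasurableSpace Ω] (ℙ : Measure Ω)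
    (Z : ℕ → Ω → State N × Fin N) : Prop where
  measurable : ∀ n, Measurable (Z n)
  markov : ∀ (n : ℕ) (a : ℕ → State N × Fin N),
    ℙ.real {ω | ∀ k ≤ n + 1, Z k ω = a k} =
      ℙ.real {ω | ∀ k ≤ n, Z k ω = a k} * transitionStar N p (a n) (a (n + 1))

variable {N} in
/-- Cumulative profit `S_n` of the ensemble of `N` players after `n` turns. -/
def cumProfit {Ω : Type*} (Z : ℕ → Ω → State N × Fin N) (n : ℕ) (ω : Ω) : ℝ :=
  ∑ k ∈ Finset.range n, payoff (Z k ω) (Z (k + 1) ω)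

/-- `m` is the mean parameter in the strong law of large numbers: for the chain with any initial
distribution, `S_n / n → m` almost surely. -/
def IsMeanProfit (m : ℝ) : Prop :=
  ∀ (Ω : Type) [MeasurableSpace Ω] (ℙ : Measure Ω) [IsProbabilityMeasure ℙ]
    (Z : ℕ → Ω → State N × Fin N), IsGameChain N p ℙ Z →
      ∀ᵐ ω ∂ℙ, Tendsto (fun n : ℕ => cumProfit Z n ω / n) atTop (𝓝 m)

/-- `μ^N(p_0, p_1, p_2, p_3)`, the mean profit per turn to the ensemble of `N` players, that is, the
almost sure limit of `S_n / n` (an arbitrary number if there is no such constant limit). -/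
def meanProfit : ℝ := Classical.epsilon (IsMeanProfit N p)

end Model

/-- The parameter vector `(q_3, q_2, q_1, q_0)`, where `q_m = 1 - p_m`. -/
def dual (p : Fin 4 → ℝ) : Fin 4 → ℝ := ![1 - p 3, 1 - p 2, 1 - p 1, 1 - p 0]

end CoopParrondo

end

/-! Ergodicity is assumed only for the chain of statuses, so the strong law is proved by a
martingale argument. In state `x` with player `i` to move, the expected payoff is `2 p_{m_i(x)} -
1`; let `f(x)` be its average over `i` and `m = π ⬝ᵥ f`. Ergodicity makes the Poisson equation `u -
P u = f - m` solvable (`exists_poisson`), and `u` lifts to a function `g` on pairs `(x, i)` for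
which payoff `- m + g(new) - g(old)` has conditional mean zero. Sums of such increments are `o(n)`
almost surely (`ae_tendsto_sum_increments_div`) and the `g` terms telescope to a bounded quantity,
so `S_n / n → m`.

This formula exhibits `m` as an average of the numbers `2 p_k - 1`, which is (b). For (a),
interchanging winners and losers turns the game with parameter `p` into the game with parameter
`dual p` and negates every payoff. Limits are compared through `IsMeanProfit.unique`. -/

namespace CoopParrondo

/-! ### Ergodic finite chains and the Poisson equation -/

section FiniteChains

variable {S : Type*} [Fintype S] [DecidableEq S]

/-- Dual form of convergence in distribution, obtained by starting the chain at the point mass at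
`x`. -/
theorem tendsto_pow_mulVec {P : Matrix S S ℝ} {π : S → ℝ}
    (h : ∀ ν ∈ stdSimplex ℝ S, Tendsto (fun n : ℕ => ν ᵥ* P ^ n) atTop (𝓝 π))
    (f : S → ℝ) (x : S) :
    Tendsto (fun n : ℕ => (P ^ n *ᵥ f) x) atTop (𝓝 (π ⬝ᵥ f)) := by
  have h1 := h (Pi.single x 1) (single_mem_stdSimplex ℝ x)
  have h2 : Continuous fun v : S → ℝ => v ⬝ᵥ f := by
    unfold dotProduct; fun_prop
  have h3 := (h2.tendsto π).comp h1
  refine h3.congr fun n => ?_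
  simp only [Function.comp, ← Matrix.dotProduct_mulVec, single_one_dotProduct]

/-- The Poisson equation of an ergodic finite chain is solvable. -/
theorem exists_poisson {P : Matrix S S ℝ} {π : S → ℝ}
    (hπ : IsStationary P π)
    (h : ∀ ν ∈ stdSimplex ℝ S, Tendsto (fun n : ℕ => ν ᵥ* P ^ n) atTop (𝓝 π))
    (f : S → ℝ) : ∃ u : S → ℝ, ∀ x, u x - (P *ᵥ u) x = f x - π ⬝ᵥ f := by
  have hsum : π ⬝ᵥ (1 : S → ℝ) = 1 := by
    simpa [dotProduct] using hπ.1.2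
  have hP : ∀ g : S → ℝ, π ⬝ᵥ (P *ᵥ g) = π ⬝ᵥ g := fun g => by
    rw [Matrix.dotProduct_mulVec, hπ.2]
  -- `I - P` kills the constants; the rank-one term `g ↦ (π ⬝ᵥ g) • 1` repairs this and makes the
  -- operator invertible.
  let L : (S → ℝ) →ₗ[ℝ] (S → ℝ) :=
    { toFun := fun g => g - P *ᵥ g + (π ⬝ᵥ g) • (1 : S → ℝ)
      map_add' := fun g g' => by
        simp only [Matrix.mulVec_add, dotProduct_add, add_smul]; abel
      map_smul' := fun c g => by
        simp only [Matrix.mulVec_smul, dotProduct_smul, RingHom.id_apply, smul_add, smul_sub,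
          smul_eq_mul, mul_smul] }
  have hL : ∀ g, L g = g - P *ᵥ g + (π ⬝ᵥ g) • (1 : S → ℝ) := fun _ => rfl
  have hπL : ∀ g, π ⬝ᵥ L g = π ⬝ᵥ g := fun g => by
    rw [hL, dotProduct_add, dotProduct_sub, hP, dotProduct_smul, hsum]; simp
  have hinj : Function.Injective L := by
    rw [← LinearMap.ker_eq_bot, LinearMap.ker_eq_bot']
    intro g hg
    have h0 : π ⬝ᵥ g = 0 := by rw [← hπL, hg, dotProduct_zero]
    have h1 : P *ᵥ g = g := by
      have := hL g
      rw [hg, h0, zero_smul, add_zero] at this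
      exact (sub_eq_zero.1 this.symm).symm
    -- An element of the kernel is harmonic with mean zero, so the constant sequence `P ^ n *ᵥ g`
    -- converges to `0`.
    have h2 : ∀ n : ℕ, P ^ n *ᵥ g = g := fun n => by
      induction n with
      | zero => simp
      | succ n ih => rw [pow_succ, ← Matrix.mulVec_mulVec, h1, ih]
    funext x
    have h3 := tendsto_pow_mulVec h g x
    simp only [h2, h0] at h3
    exact tendsto_nhds_unique tendsto_const_nhds h3
  obtain ⟨u, hu⟩ := LinearMap.injective_iff_surjective.1 hinj f
  refine ⟨u, fun x => ?_⟩
  -- Pairing `L u = f` with `π` gives `π ⬝ᵥ u = π ⬝ᵥ f`, so the correction term is exactly the mean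
  -- of `f`.
  have h4 := hπL u
  rw [hu] at h4
  rw [h4]
  have := congrFun (hL u) x
  rw [hu] at this
  simp at this
  linarith

theorem IsErgodic.submatrix {P : Matrix S S ℝ} (h : IsErgodic P) (e : S ≃ S) :
    IsErgodic (P.submatrix e e) := by
  have hpow : ∀ n : ℕ, (P.submatrix e e) ^ n = (P ^ n).submatrix e e := fun n => by
    induction n with
    | zero => simp
    | succ n ih => rw [pow_succ, pow_succ, ih, Matrix.submatrix_mul_equiv]
  have hvec : ∀ (ν : S → ℝ) (Q : Matrix S S ℝ),
      ν ᵥ* Q.submatrix e e = ((ν ∘ e.symm) ᵥ* Q) ∘ e := fun ν Q => by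
    funext y
    simp only [Matrix.vecMul, dotProduct, Function.comp, Matrix.submatrix_apply]
    exact Fintype.sum_equiv e _ _ (by simp)
  have hsimp : ∀ (e : S ≃ S) (ν : S → ℝ), ν ∈ stdSimplex ℝ S → ν ∘ e ∈ stdSimplex ℝ S :=
    fun e ν hν => ⟨fun x => hν.1 _, by
      rw [← hν.2]; exact Fintype.sum_equiv e _ _ (fun _ => rfl)⟩
  obtain ⟨π, hπ, huniq, hlim⟩ := h
  refine ⟨π ∘ e, ⟨hsimp e _ hπ.1, ?_⟩, fun π' hπ' => ?_, fun ν hν => ?_⟩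
  · rw [hvec]
    simp [Function.comp_assoc, hπ.2]
  · have h1 := hπ'.2
    rw [hvec] at h1
    have : π' ∘ e.symm = π := huniq _ ⟨hsimp _ _ hπ'.1, by
      conv_rhs => rw [← h1]
      simp [Function.comp_assoc]⟩
    rw [← this]
    simp [Function.comp_assoc]
  · simp only [hpow, hvec]
    have h1 := hlim _ (hsimp e.symm ν hν)
    rw [tendsto_pi_nhds] at h1 ⊢
    exact fun x => h1 (e x)

end FiniteChains

/-! ### Interpolation between squares -/

/-- A sequence with bounded increments that is `o(k)` along the squares is `o(k)`. -/
theorem tendsto_div_of_tendsto_div_sq {M : ℕ → ℝ} {C : ℝ} (hM : ∀ n, |M (n + 1) - M n| ≤ C)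
    (h : Tendsto (fun k : ℕ => M (k ^ 2) / (k : ℝ) ^ 2) atTop (𝓝 0)) :
    Tendsto (fun n : ℕ => M n / n) atTop (𝓝 0) := by
  have hC : 0 ≤ C := (abs_nonneg _).trans (hM 0)
  have hgap : ∀ m n : ℕ, |M (m + n) - M m| ≤ n * C := fun m n => by
    induction n with
    | zero => simp
    | succ n ih =>
      have := abs_sub_le (M (m + (n + 1))) (M (m + n)) (M m)
      have h2 := hM (m + n)
      rw [← add_assoc] at *
      push_cast
      linarith
  have hsqrt : Tendsto Nat.sqrt atTop atTop :=
    tendsto_atTop.2 fun b => (eventually_ge_atTop (b * b)).mono fun n hn => Nat.le_sqrt.2 hn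
  have h1 : Tendsto (fun k : ℕ => |M (k ^ 2) / (k : ℝ) ^ 2| + 2 * C * (k : ℝ)⁻¹) atTop (𝓝 0) := by
    have := h.abs.add ((tendsto_inv_atTop_nhds_zero_nat (𝕜 := ℝ)).const_mul (2 * C))
    simpa using this
  refine squeeze_zero_norm' ?_ (h1.comp hsqrt)
  filter_upwards [eventually_ge_atTop 1] with n hn
  have hk : 0 < n.sqrt := Nat.sqrt_pos.2 hn
  have hk2 : n.sqrt ^ 2 ≤ n := Nat.sqrt_le' n
  have hk3 : n - n.sqrt ^ 2 ≤ 2 * n.sqrt := by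
    have := Nat.sqrt_le_add n
    rw [pow_two]; omega
  simp only [Function.comp, Real.norm_eq_abs]
  set k := n.sqrt
  have hkR : (0 : ℝ) < k := by exact_mod_cast hk
  have hnk : (k : ℝ) ^ 2 ≤ n := by exact_mod_cast hk2
  have h3 : |M n - M (k ^ 2)| ≤ 2 * k * C := by
    have := hgap (k ^ 2) (n - k ^ 2)
    rw [Nat.add_sub_cancel' hk2] at this
    refine this.trans (mul_le_mul_of_nonneg_right ?_ hC)
    exact_mod_cast hk3
  have h4 : |M n| ≤ |M (k ^ 2)| + 2 * k * C := by
    have := abs_sub_abs_le_abs_sub (M n) (M (k ^ 2)); linarith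
  have hk2R : (0 : ℝ) < (k : ℝ) ^ 2 := by positivity
  rw [abs_div, abs_div, abs_of_pos hk2R, Nat.abs_cast]
  calc |M n| / n ≤ (|M (k ^ 2)| + 2 * k * C) / (k : ℝ) ^ 2 :=
        div_le_div₀ (by positivity) h4 hk2R hnk
    _ = _ := by field_simp

theorem exists_forall_abs_le {S : Type*} [Fintype S] (d : S → S → ℝ) :
    ∃ C, ∀ a b, |d a b| ≤ C :=
    ⟨∑ s : S × S, |d s.1 s.2|, fun a b => Finset.single_le_sum
      (f := fun s : S × S => |d s.1 s.2|) (fun _ _ => abs_nonneg _) (Finset.mem_univ (a, b))⟩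

/-! ### Strong law for centred increments -/

section LawOfLargeNumbers

variable {S : Type*} [Fintype S] [MeasurableSpace S] [MeasurableSingletonClass S]
  {Ω : Type*} [MeasurableSpace Ω] {ℙ : Measure Ω} [IsProbabilityMeasure ℙ] {Z : ℕ → Ω → S}
  {P : Matrix S S ℝ}

theorem measurable_sum_increments (hZ : ∀ n, Measurable (Z n)) (d : S → S → ℝ) (n : ℕ) :
    Measurable fun ω => ∑ k ∈ Finset.range n, d (Z k ω) (Z (k + 1) ω) :=
  Finset.measurable_fun_sum _ fun k _ =>
    (measurable_of_finite fun s : S × S => d s.1 s.2).comp ((hZ k).prodMk (hZ (k + 1)))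

/-- A centred increment of a finite Markov chain is orthogonal to the past. -/
theorem integral_past_mul_increment (hZ : ∀ n, Measurable (Z n))
    (hmarkov : ∀ (n : ℕ) (a : ℕ → S), ℙ.real {ω | ∀ k ≤ n + 1, Z k ω = a k} =
      ℙ.real {ω | ∀ k ≤ n, Z k ω = a k} * P (a n) (a (n + 1)))
    {d : S → S → ℝ} (hd : ∀ a, ∑ b, P a b * d a b = 0) (n : ℕ) (G : (ℕ → S) → ℝ)
    (hG : ∀ a a' : ℕ → S, (∀ k ≤ n, a k = a' k) → G a = G a') :
    ∫ ω, G (fun k => Z k ω) * d (Z n ω) (Z (n + 1) ω) ∂ℙ = 0 := by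
  classical
  -- `ext a b` is the path `a` up to time `n`, continued by the constant `b`; the cylinders `A a b`
  -- partition `Ω` according to the first `n + 2` states.
  obtain ⟨ext, hlow, hhigh⟩ : ∃ ext : (Fin (n + 1) → S) → S → ℕ → S,
      (∀ a b k, (hk : k ≤ n) → ext a b k = a ⟨k, Nat.lt_succ_of_le hk⟩) ∧
        ∀ a b, ext a b (n + 1) = b :=
    ⟨fun a b k => if hk : k < n + 1 then a ⟨k, hk⟩ else b,
      fun a b k hk => dif_pos (Nat.lt_succ_of_le hk), fun a b => dif_neg (lt_irrefl _)⟩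
  let A : (Fin (n + 1) → S) → S → Set Ω := fun a b => {ω | ∀ k ≤ n + 1, Z k ω = ext a b k}
  have hA : ∀ a b, MeasurableSet (A a b) := fun a b => by
    have : A a b = ⋂ k, ⋂ (_ : k ≤ n + 1), Z k ⁻¹' {ext a b k} := by ext; simp [A]
    rw [this]
    exact MeasurableSet.iInter fun k => MeasurableSet.iInter fun _ =>
      hZ k (measurableSet_singleton _)
  have hpt : ∀ ω, G (fun k => Z k ω) * d (Z n ω) (Z (n + 1) ω) =
      ∑ a, ∑ b, (A a b).indicator (fun _ => G (ext a b) * d (ext a b n) b) ω := fun ω => by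
    have hmem : ∀ a b, ω ∈ A a b ↔ a = (fun i : Fin (n + 1) => Z i ω) ∧ b = Z (n + 1) ω := fun a b => by
      constructor
      · intro h
        refine ⟨funext fun i => ?_, ?_⟩
        · have := h i (by omega)
          rw [hlow _ _ _ (by omega)] at this
          exact this.symm
        · have := h (n + 1) le_rfl
          rw [hhigh] at this
          exact this.symm
      · rintro ⟨rfl, rfl⟩ k hk
        rcases Nat.lt_or_ge k (n + 1) with h | h
        · exact (hlow (fun i => Z i ω) _ k (by omega)).symm
        · obtain rfl : k = n + 1 := by omega
          exact (hhigh _ _).symm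
    rw [Finset.sum_eq_single (fun i : Fin (n + 1) => Z i ω), Finset.sum_eq_single (Z (n + 1) ω),
      Set.indicator_of_mem ((hmem _ _).2 ⟨rfl, rfl⟩)]
    · exact congrArg₂ _ (hG _ _ fun k hk => (hlow (fun i => Z i ω) _ k hk).symm)
        (congrArg₂ d (hlow (fun i => Z i ω) _ n le_rfl).symm rfl)
    · intro b _ hb
      exact Set.indicator_of_notMem (fun h => hb ((hmem _ _).1 h).2) _
    · simp
    · intro a _ ha
      exact Finset.sum_eq_zero fun b _ =>
        Set.indicator_of_notMem (fun h => ha ((hmem _ _).1 h).1) _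
    · simp
  simp only [hpt]
  rw [integral_finsetSum _ fun a _ => integrable_finsetSum _ fun b _ =>
    (integrable_const _).indicator (hA a b)]
  refine Finset.sum_eq_zero fun a _ => ?_
  rw [integral_finsetSum _ fun b _ => (integrable_const _).indicator (hA a b)]
  simp only [integral_indicator_const _ (hA a _)]
  -- The continuation value `a 0` is arbitrary: `G` and the past event see only times up to `n`.
  -- What still depends on `b` is the factor summed in `hd`.
  have hterm : ∀ b, ℙ.real (A a b) • (G (ext a b) * d (ext a b n) b) =
      ℙ.real {ω | ∀ k ≤ n, Z k ω = ext a (a 0) k} * G (ext a (a 0)) *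
        (P (a (Fin.last n)) b * d (a (Fin.last n)) b) := fun b => by
    have h1 : {ω | ∀ k ≤ n, Z k ω = ext a b k} = {ω | ∀ k ≤ n, Z k ω = ext a (a 0) k} := by
      ext ω
      simp only [Set.mem_ofPred_eq]
      exact forall₂_congr fun k hk => by rw [hlow _ _ _ hk, hlow _ _ _ hk]
    have h2 : G (ext a b) = G (ext a (a 0)) := hG _ _ fun k hk => by
      rw [hlow _ _ _ hk, hlow _ _ _ hk]
    have h3 : ext a b n = a (Fin.last n) := hlow _ _ _ le_rfl
    simp only [A]
    rw [hmarkov, h1, h2, h3, hhigh, smul_eq_mul]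
    ring
  simp only [hterm, ← Finset.mul_sum, hd, mul_zero]

/-- Orthogonality to the past removes the cross terms, so each step adds at most `C ^ 2` to the
second moment. -/
theorem integral_sum_increments_sq_le (hZ : ∀ n, Measurable (Z n))
    (hmarkov : ∀ (n : ℕ) (a : ℕ → S), ℙ.real {ω | ∀ k ≤ n + 1, Z k ω = a k} =
      ℙ.real {ω | ∀ k ≤ n, Z k ω = a k} * P (a n) (a (n + 1)))
    {d : S → S → ℝ} (hd : ∀ a, ∑ b, P a b * d a b = 0) {C : ℝ} (hC : ∀ a b, |d a b| ≤ C)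
    (n : ℕ) :
    ∫ ω, (∑ k ∈ Finset.range n, d (Z k ω) (Z (k + 1) ω)) ^ 2 ∂ℙ ≤ n * C ^ 2 := by
  set M : ℕ → Ω → ℝ := fun n ω => ∑ k ∈ Finset.range n, d (Z k ω) (Z (k + 1) ω) with hMdef
  have hMm : ∀ n, Measurable (M n) := measurable_sum_increments hZ d
  have hDm : ∀ n, Measurable fun ω => d (Z n ω) (Z (n + 1) ω) := fun n =>
    (measurable_of_finite fun s : S × S => d s.1 s.2).comp ((hZ n).prodMk (hZ (n + 1)))
  have hMb : ∀ n ω, |M n ω| ≤ n * C := fun n ω => by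
    refine (Finset.abs_sum_le_sum_abs _ _).trans ?_
    refine (Finset.sum_le_sum fun k _ => hC _ _).trans ?_
    simp
  have hint : ∀ {f : Ω → ℝ} (c : ℝ), Measurable f → (∀ ω, |f ω| ≤ c) → Integrable f ℙ :=
    fun c hf hb => Integrable.of_bound hf.aestronglyMeasurable c (ae_of_all _ hb)
  have hsqint : ∀ n, Integrable (fun ω => M n ω ^ 2) ℙ := fun n =>
    hint ((n * C) ^ 2) ((hMm n).pow_const 2) fun ω => by
      rw [abs_pow]; exact pow_le_pow_left₀ (abs_nonneg _) (hMb n ω) 2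
  induction n with
  | zero => simp
  | succ n ih =>
    have h0 := integral_past_mul_increment hZ hmarkov hd n
      (fun a => ∑ k ∈ Finset.range n, d (a k) (a (k + 1))) fun a a' h =>
        Finset.sum_congr rfl fun k hk => by
          have := Finset.mem_range.1 hk
          rw [h k (by omega), h (k + 1) (by omega)]
    have hcross : Integrable (fun ω => M n ω * d (Z n ω) (Z (n + 1) ω)) ℙ :=
      hint (n * C * C) ((hMm n).mul (hDm n)) fun ω => by
        rw [abs_mul]
        exact mul_le_mul (hMb n ω) (hC _ _) (abs_nonneg _) ((abs_nonneg _).trans (hMb n ω))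
    have hstep : ∀ ω, M (n + 1) ω ^ 2 ≤
        M n ω ^ 2 + 2 * (M n ω * d (Z n ω) (Z (n + 1) ω)) + C ^ 2 := fun ω => by
      have h1 : M (n + 1) ω = M n ω + d (Z n ω) (Z (n + 1) ω) := Finset.sum_range_succ _ _
      have h2 : d (Z n ω) (Z (n + 1) ω) ^ 2 ≤ C ^ 2 := by
        rw [← sq_abs]; exact pow_le_pow_left₀ (abs_nonneg _) (hC _ _) 2
      rw [h1]; nlinarith
    calc ∫ ω, M (n + 1) ω ^ 2 ∂ℙ
        ≤ ∫ ω, (M n ω ^ 2 + 2 * (M n ω * d (Z n ω) (Z (n + 1) ω)) + C ^ 2) ∂ℙ :=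
          integral_mono (hsqint _)
            (((hsqint n).add (hcross.const_mul 2)).add (integrable_const _)) hstep
      _ = ∫ ω, M n ω ^ 2 ∂ℙ + C ^ 2 := by
          have hadd : Integrable
              (fun ω => M n ω ^ 2 + 2 * (M n ω * d (Z n ω) (Z (n + 1) ω))) ℙ :=
            (hsqint n).add (hcross.const_mul 2)
          rw [integral_add hadd (integrable_const _),
            integral_add (hsqint n) (hcross.const_mul 2), integral_const_mul]
          simp only [hMdef] at h0 ⊢
          rw [h0]; simp
      _ ≤ ((n + 1 : ℕ) : ℝ) * C ^ 2 := by push_cast; linarith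

/-- Strong law of large numbers for centred functionals of the transitions of a finite chain. -/
theorem ae_tendsto_sum_increments_div (hZ : ∀ n, Measurable (Z n))
    (hmarkov : ∀ (n : ℕ) (a : ℕ → S), ℙ.real {ω | ∀ k ≤ n + 1, Z k ω = a k} =
      ℙ.real {ω | ∀ k ≤ n, Z k ω = a k} * P (a n) (a (n + 1)))
    {d : S → S → ℝ} (hd : ∀ a, ∑ b, P a b * d a b = 0) :
    ∀ᵐ ω ∂ℙ, Tendsto (fun n : ℕ => (∑ k ∈ Finset.range n, d (Z k ω) (Z (k + 1) ω)) / n)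
      atTop (𝓝 0) := by
  obtain ⟨C, hC⟩ : ∃ C, ∀ a b, |d a b| ≤ C := exists_forall_abs_le d
  set M : ℕ → Ω → ℝ := fun n ω => ∑ k ∈ Finset.range n, d (Z k ω) (Z (k + 1) ω) with hMdef
  have hMm : ∀ n, Measurable (M n) := measurable_sum_increments hZ d
  -- Second moments at time `n` are `O(1/n)` after normalisation, which is not summable; along the
  -- squares they are `O(1/k ^ 2)`, so `∑ F k` is almost surely finite and `F k → 0`.
  let F : ℕ → Ω → ℝ := fun k ω => (M (k ^ 2) ω / (k : ℝ) ^ 2) ^ 2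
  have hFm : ∀ k, Measurable (F k) := fun k => ((hMm _).div_const _).pow_const 2
  have hF0 : ∀ k ω, 0 ≤ F k ω := fun k ω => sq_nonneg _
  have hFle : ∀ k, ∫ ω, F k ω ∂ℙ ≤ C ^ 2 * (1 / (k : ℝ) ^ 2) := fun k => by
    simp only [F, div_pow]
    rw [integral_div]
    have h1 := integral_sum_increments_sq_le hZ hmarkov hd hC (k ^ 2)
    rcases Nat.eq_zero_or_pos k with rfl | hk
    · simp
    · have hk : (0 : ℝ) < k := by exact_mod_cast hk
      rw [div_le_iff₀ (by positivity)]
      refine h1.trans (le_of_eq ?_)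
      push_cast
      field_simp
  have hFint : ∀ k, Integrable (F k) ℙ := fun k => by
    refine Integrable.of_bound (hFm k).aestronglyMeasurable
      ((((k ^ 2 : ℕ) * C) / (k : ℝ) ^ 2) ^ 2) (ae_of_all _ fun ω => ?_)
    simp only [F, Real.norm_eq_abs]
    rw [abs_pow, abs_div, abs_of_nonneg (sq_nonneg (k : ℝ))]
    refine pow_le_pow_left₀ (by positivity) (div_le_div_of_nonneg_right ?_ (by positivity)) 2
    refine (Finset.abs_sum_le_sum_abs _ _).trans ?_
    refine (Finset.sum_le_sum fun k _ => hC _ _).trans ?_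
    simp
  have hfin : ∑' k, ∫⁻ ω, ENNReal.ofReal (F k ω) ∂ℙ ≠ ⊤ := by
    have hs : Summable fun k : ℕ => C ^ 2 * (1 / (k : ℝ) ^ 2) :=
      (Real.summable_one_div_nat_pow.2 (by norm_num)).mul_left _
    refine ne_top_of_le_ne_top hs.tsum_ofReal_ne_top (ENNReal.tsum_le_tsum fun k => ?_)
    rw [← ofReal_integral_eq_lintegral_ofReal (hFint k) (ae_of_all _ (hF0 k))]
    exact ENNReal.ofReal_le_ofReal (hFle k)
  rw [← lintegral_tsum fun k => (hFm k).ennreal_ofReal.aemeasurable] at hfin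
  have hae := ae_lt_top (Measurable.tsum fun k => (hFm k).ennreal_ofReal) hfin
  filter_upwards [hae] with ω hω
  refine tendsto_div_of_tendsto_div_sq (M := fun n => M n ω) (C := C) (fun n => ?_) ?_
  · simp only [hMdef, Finset.sum_range_succ, add_sub_cancel_left]
    exact hC _ _
  · have h1 := ENNReal.tendsto_atTop_zero_of_tsum_ne_top hω.ne
    have h2 : Tendsto (fun k => F k ω) atTop (𝓝 0) := by
      have := (ENNReal.tendsto_toReal ENNReal.zero_ne_top).comp h1
      simpa [Function.comp_def, ENNReal.toReal_ofReal (hF0 _ ω)] using this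
    have h3 := h2.sqrt
    simp only [F, Real.sqrt_sq_eq_abs, Real.sqrt_zero] at h3
    exact (tendsto_zero_iff_abs_tendsto_zero _).2 h3

end LawOfLargeNumbers

/-! ### Construction of a chain -/

/-- A finite Markov chain with given transition matrix and deterministic initial state exists. -/
theorem exists_markov_chain {S : Type} [Fintype S] [MeasurableSpace S]
    [MeasurableSingletonClass S] (s₀ : S) {P : Matrix S S ℝ} (h0 : ∀ a b, 0 ≤ P a b)
    (h1 : ∀ a, ∑ b, P a b = 1) :
    ∃ (Ω : Type) (_ : MeasurableSpace Ω) (ℙ : Measure Ω) (_ : IsProbabilityMeasure ℙ)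
      (Z : ℕ → Ω → S), (∀ n, Measurable (Z n)) ∧
      ∀ (n : ℕ) (a : ℕ → S), ℙ.real {ω | ∀ k ≤ n + 1, Z k ω = a k} =
        ℙ.real {ω | ∀ k ≤ n, Z k ω = a k} * P (a n) (a (n + 1)) := by
  classical
  let row : ℕ × S → PMF S := fun i => PMF.ofFintype (fun b => ENNReal.ofReal (P i.2 b)) (by
    rw [← ENNReal.ofReal_sum_of_nonneg fun b _ => h0 _ b, h1, ENNReal.ofReal_one])
  -- Independent coordinates: `ω (k, s)` is the successor to use if the chain is at `s` at time `k`.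
  -- A path reads one coordinate per time, so its probability is a product.
  let ℙ : Measure (ℕ × S → S) := Measure.infinitePi fun i => (row i).toMeasure
  let Z : ℕ → (ℕ × S → S) → S := fun n ω => Nat.rec s₀ (fun k s => ω (k, s)) n
  have hZ0 : ∀ ω, Z 0 ω = s₀ := fun _ => rfl
  have hZs : ∀ n ω, Z (n + 1) ω = ω (n, Z n ω) := fun _ _ => rfl
  have hmeas : ∀ n, Measurable (Z n) := fun n => by
    induction n with
    | zero => exact measurable_const
    | succ n ih =>
      have : Measurable fun q : S × (ℕ × S → S) => q.2 (n, q.1) :=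
        measurable_from_prod_countable_right fun s => measurable_pi_apply (n, s)
      exact this.comp (ih.prodMk measurable_id)
  have hlaw : ∀ (n : ℕ) (a : ℕ → S), ℙ.real {ω | ∀ k ≤ n, Z k ω = a k} =
      if a 0 = s₀ then ∏ k ∈ Finset.range n, P (a k) (a (k + 1)) else 0 := fun n a => by
    split_ifs with ha
    · have hset : {ω | ∀ k ≤ n, Z k ω = a k} =
          Set.pi ((Finset.range n).image fun k => (k, a k) : Finset (ℕ × S))
            fun i => {a (i.1 + 1)} := by
        ext ω
        simp only [Set.mem_ofPred_eq, Set.mem_pi, Finset.coe_image, Set.mem_image,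
          Finset.coe_range, Set.mem_Iio, Set.mem_singleton_iff]
        constructor
        · rintro h _ ⟨k, hk, rfl⟩
          have := h (k + 1) hk
          rwa [hZs, h k hk.le] at this
        · intro h k
          induction k with
          | zero => intro _; rw [hZ0, ha]
          | succ k ih =>
            intro hk
            rw [hZs, ih (by omega)]
            exact h _ ⟨k, hk, rfl⟩
      rw [hset, Measure.real, Measure.infinitePi_pi _ fun i _ => measurableSet_singleton _,
        Finset.prod_image fun k _ l _ h => congrArg Prod.fst h, ENNReal.toReal_prod]
      refine Finset.prod_congr rfl fun k _ => ?_
      rw [PMF.toMeasure_apply_singleton _ _ (measurableSet_singleton _)]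
      simp [row, ENNReal.toReal_ofReal (h0 _ _)]
    · have : {ω | ∀ k ≤ n, Z k ω = a k} = ∅ :=
        Set.eq_empty_of_forall_notMem fun ω h => ha (h 0 (Nat.zero_le _)).symm
      rw [this, measureReal_empty]
  refine ⟨_, _, ℙ, inferInstance, Z, hmeas, fun n a => ?_⟩
  rw [hlaw, hlaw, ite_mul, Finset.prod_range_succ, zero_mul]

/-! ### The game: mean profit and duality -/

section Model

variable {N : ℕ}

theorem flip_ne (x : State N) (i : Fin N) : flip x i ≠ x := fun h => by
  have h1 := congrFun h i
  have h2 : ∀ s : Fin 2, 1 - s ≠ s := by decide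
  simp only [flip, Function.update_self] at h1
  exact h2 _ h1

/-- Interchange of winners and losers. -/
def compl : State N ≃ State N where
  toFun x i := 1 - x i
  invFun x i := 1 - x i
  left_inv x := by simp
  right_inv x := by simp

theorem compl_apply (x : State N) (i : Fin N) : compl x i = 1 - x i := rfl

theorem compl_compl (x : State N) : compl (compl x) = x := compl.left_inv x

theorem flip_compl (x : State N) (i : Fin N) : flip (compl x) i = compl (flip x i) := by
  funext j
  by_cases h : j = i
  · subst h; simp [flip, compl_apply]
  · simp [flip, compl_apply, h]

variable [NeZero N]

theorem changeProb_add_keepProb (p : Fin 4 → ℝ) (x : State N) (i : Fin N) :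
    changeProb p x i + keepProb p x i = 1 := by
  unfold changeProb keepProb; split_ifs <;> ring

theorem sum_transitionStar_mul (p : Fin 4 → ℝ) (a : State N × Fin N)
    (F : State N × Fin N → ℝ) :
    ∑ b, transitionStar N p a b * F b =
      (N : ℝ)⁻¹ * ∑ j, (changeProb p a.1 a.2 * F (flip a.1 a.2, j) +
        keepProb p a.1 a.2 * F (a.1, j)) := by
  have h : ∀ b : State N × Fin N, transitionStar N p a b * F b =
      (if b.1 = flip a.1 a.2 then (N : ℝ)⁻¹ * changeProb p a.1 a.2 * F b else 0) +
        if b.1 = a.1 then (N : ℝ)⁻¹ * keepProb p a.1 a.2 * F b else 0 := fun b => by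
    unfold transitionStar
    split_ifs with h1 h2
    · exact absurd (h1.symm.trans h2) (flip_ne _ _)
    all_goals ring
  simp only [h]
  rw [Fintype.sum_prod_type_right, Finset.mul_sum]
  refine Finset.sum_congr rfl fun j _ => ?_
  simp only [Finset.sum_add_distrib, Finset.sum_ite_eq', Finset.mem_univ, if_true]
  ring

theorem sum_transitionStar (p : Fin 4 → ℝ) (a : State N × Fin N) :
    ∑ b, transitionStar N p a b = 1 := by
  have hN : (N : ℝ) ≠ 0 := Nat.cast_ne_zero.2 (NeZero.ne N)
  simpa [changeProb_add_keepProb, hN] using sum_transitionStar_mul p a fun _ => 1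

theorem transitionStar_nonneg {p : Fin 4 → ℝ} (hp : ∀ m, p m ∈ Set.Icc (0 : ℝ) 1)
    (a b : State N × Fin N) : 0 ≤ transitionStar N p a b := by
  have h0 := fun m => (hp m).1
  have h1 := fun m => sub_nonneg.2 (hp m).2
  have hN : (0 : ℝ) ≤ (N : ℝ)⁻¹ := by positivity
  unfold transitionStar changeProb keepProb
  split_ifs <;> first | exact mul_nonneg hN (h0 _) | exact mul_nonneg hN (h1 _) | exact le_rfl

theorem transition_mulVec (p : Fin 4 → ℝ) (u : State N → ℝ) (x : State N) :
    (transition N p *ᵥ u) x =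
      (N : ℝ)⁻¹ * ∑ i, (changeProb p x i * u (flip x i) + keepProb p x i * u x) := by
  have h : ∀ y, transition N p x y * u y =
      (if y = x then (N : ℝ)⁻¹ * (∑ i, keepProb p x i) * u y else 0) +
        ∑ i, if y = flip x i then (N : ℝ)⁻¹ * changeProb p x i * u y else 0 := fun y => by
    unfold transition
    split_ifs with h1
    · subst h1
      simp [(flip_ne y _).symm]
    · simp only [Finset.sum_mul, ite_mul, zero_mul, zero_add]
  simp only [Matrix.mulVec, dotProduct, h]
  rw [Finset.sum_add_distrib, Finset.sum_comm]
  simp only [Finset.sum_ite_eq', Finset.mem_univ, if_true, Finset.sum_add_distrib,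
    Finset.mul_sum, Finset.sum_mul, mul_add, mul_assoc]
  rw [add_comm]

/-- The mean payoff of a turn is `2 p_{m_i(x)} - 1`. -/
theorem changeProb_mul_payoff_add (p : Fin 4 → ℝ) (x : State N) (i j : Fin N) :
    changeProb p x i * payoff (x, i) (flip x i, j) + keepProb p x i * payoff (x, i) (x, j) =
      2 * p (nbr x i) - 1 := by
  have h : x i = 0 ∨ x i = 1 := by
    generalize x i = s
    revert s; decide
  rcases h with h | h <;> simp [changeProb, keepProb, payoff, flip, h] <;> ring

/-- The explicit value serves the bounds in (b); the proof transfers the Poisson solution from the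
statuses to the chain with players. -/
theorem IsErgodic.exists_isMeanProfit {p : Fin 4 → ℝ} (herg : IsErgodic (transition N p)) :
    ∃ π ∈ stdSimplex ℝ (State N),
      IsMeanProfit N p (π ⬝ᵥ fun x => (N : ℝ)⁻¹ * ∑ i, (2 * p (nbr x i) - 1)) := by
  have hN : (N : ℝ) ≠ 0 := Nat.cast_ne_zero.2 (NeZero.ne N)
  obtain ⟨π, hπ, -, hlim⟩ := herg
  refine ⟨π, hπ.1, ?_⟩
  obtain ⟨u, hu⟩ := exists_poisson hπ hlim fun x => (N : ℝ)⁻¹ * ∑ i, (2 * p (nbr x i) - 1)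
  set m := π ⬝ᵥ fun x : State N => (N : ℝ)⁻¹ * ∑ i, (2 * p (nbr x i) - 1)
  -- Centred expected payoff plus the expected value of `u` after the turn. Averaging over the
  -- player returns `u` by the Poisson equation; since the next player is uniform, `g` solves the
  -- Poisson equation of the larger chain.
  let g : State N × Fin N → ℝ := fun a => 2 * p (nbr a.1 a.2) - 1 - m +
    (changeProb p a.1 a.2 * u (flip a.1 a.2) + keepProb p a.1 a.2 * u a.1)
  have hg : ∀ y, (N : ℝ)⁻¹ * ∑ j, g (y, j) = u y := fun y => by
    have h1 := hu y
    rw [transition_mulVec] at h1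
    simp only [g, Finset.sum_add_distrib (f := fun j => 2 * p (nbr y j) - 1 - m),
      Finset.sum_sub_distrib (f := fun j => 2 * p (nbr y j) - 1), mul_add, mul_sub _ _ (∑ _, m)]
    rw [Finset.sum_const, Finset.card_univ, Fintype.card_fin, nsmul_eq_mul,
      inv_mul_cancel_left₀ hN]
    linarith
  have hd : ∀ a, ∑ b, transitionStar N p a b * (payoff a b - m + g b - g a) = 0 := fun a => by
    rw [sum_transitionStar_mul]
    have h2 : ∀ j, changeProb p a.1 a.2 *
          (payoff a (flip a.1 a.2, j) - m + g (flip a.1 a.2, j) - g a) +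
        keepProb p a.1 a.2 * (payoff a (a.1, j) - m + g (a.1, j) - g a) =
        (2 * p (nbr a.1 a.2) - 1 - m - g a) +
          (changeProb p a.1 a.2 * g (flip a.1 a.2, j) + keepProb p a.1 a.2 * g (a.1, j)) :=
      fun j => by
        linear_combination changeProb_mul_payoff_add p a.1 a.2 j -
          (m + g a) * changeProb_add_keepProb p a.1 a.2
    simp only [h2]
    rw [Finset.sum_add_distrib, Finset.sum_add_distrib, ← Finset.mul_sum, ← Finset.mul_sum,
      Finset.sum_const, Finset.card_univ, Fintype.card_fin, nsmul_eq_mul, mul_add,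
      inv_mul_cancel_left₀ hN, mul_add, mul_left_comm, hg, mul_left_comm, hg]
    simp only [g]
    ring
  intro Ω _ ℙ _ Z hZ
  filter_upwards [ae_tendsto_sum_increments_div hZ.measurable hZ.markov hd] with ω hω
  have hsum : ∀ n : ℕ, ∑ k ∈ Finset.range n,
      (payoff (Z k ω) (Z (k + 1) ω) - m + g (Z (k + 1) ω) - g (Z k ω)) =
      cumProfit Z n ω - n * m + (g (Z n ω) - g (Z 0 ω)) := fun n => by
    simp only [add_sub_assoc, Finset.sum_add_distrib,
      Finset.sum_range_sub fun k => g (Z k ω), cumProfit]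
    simp only [Finset.sum_sub_distrib, Finset.sum_const, Finset.card_range, nsmul_eq_mul]
  have hb : Tendsto (fun n : ℕ => (g (Z n ω) - g (Z 0 ω)) / n) atTop (𝓝 0) := by
    obtain ⟨B, hB⟩ := exists_forall_abs_le fun a b => g a - g b
    refine squeeze_zero_norm (fun n => ?_) (tendsto_const_div_atTop_nhds_zero_nat B)
    rw [Real.norm_eq_abs, abs_div, Nat.abs_cast]
    exact div_le_div_of_nonneg_right (hB _ _) (Nat.cast_nonneg n)
  have hlim := (hω.sub hb).add_const m
  rw [sub_zero, zero_add] at hlim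
  refine hlim.congr' ?_
  filter_upwards [eventually_ge_atTop 1] with n hn
  have hn : (n : ℝ) ≠ 0 := by positivity
  rw [hsum]
  field_simp
  ring

/-- `IsMeanProfit` quantifies over all chains and would hold vacuously if there were none, so
uniqueness needs an actual chain. -/
theorem IsMeanProfit.unique {p : Fin 4 → ℝ} (hp : ∀ m, p m ∈ Set.Icc (0 : ℝ) 1) {m m' : ℝ}
    (h : IsMeanProfit N p m) (h' : IsMeanProfit N p m') : m = m' := by
  obtain ⟨Ω, _, ℙ, _, Z, hZ, hmarkov⟩ := exists_markov_chain (P := transitionStar N p)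
    ((fun _ => 0, 0) : State N × Fin N) (transitionStar_nonneg hp) (sum_transitionStar p)
  obtain ⟨ω, h1, h2⟩ := ((h Ω ℙ Z ⟨hZ, hmarkov⟩).and (h' Ω ℙ Z ⟨hZ, hmarkov⟩)).exists
  exact tendsto_nhds_unique h1 h2

theorem IsMeanProfit.meanProfit {p : Fin 4 → ℝ} {m : ℝ} (h : IsMeanProfit N p m) :
    IsMeanProfit N p (meanProfit N p) :=
  Classical.epsilon_spec (p := IsMeanProfit N p) ⟨m, h⟩

/-- Complementing both neighbours sends `m_i` to `3 - m_i`, which is why `dual` reverses the order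
of the parameters. -/
theorem dual_nbr_compl (p : Fin 4 → ℝ) (x : State N) (i : Fin N) :
    dual p (nbr (compl x) i) = 1 - p (nbr x i) := by
  have h : ∀ s t : Fin 2, dual p ⟨2 * (1 - s).val + (1 - t).val, by omega⟩ =
      1 - p ⟨2 * s.val + t.val, by omega⟩ := fun s t => by
    fin_cases s <;> fin_cases t <;> rfl
  exact h _ _

theorem one_sub_eq_zero_iff (s : Fin 2) : 1 - s = 0 ↔ ¬ s = 0 := by revert s; decide

theorem one_sub_eq_one_iff (s : Fin 2) : 1 - s = 1 ↔ ¬ s = 1 := by revert s; decide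

theorem changeProb_dual_compl (p : Fin 4 → ℝ) (x : State N) (i : Fin N) :
    changeProb (dual p) (compl x) i = changeProb p x i := by
  simp only [changeProb, dual_nbr_compl, compl_apply, one_sub_eq_zero_iff, ite_not,
    sub_sub_cancel]

theorem keepProb_dual_compl (p : Fin 4 → ℝ) (x : State N) (i : Fin N) :
    keepProb (dual p) (compl x) i = keepProb p x i := by
  simp only [keepProb, dual_nbr_compl, compl_apply, one_sub_eq_zero_iff, ite_not,
    sub_sub_cancel]

theorem transition_dual (p : Fin 4 → ℝ) :
    transition N (dual p) = (transition N p).submatrix compl compl := by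
  have h : ∀ x y, transition N (dual p) (compl x) (compl y) = transition N p x y := fun x y => by
    simp only [transition, changeProb_dual_compl, keepProb_dual_compl, flip_compl,
      EmbeddingLike.apply_eq_iff_eq]
  ext x y
  rw [Matrix.submatrix_apply, ← h, compl_compl, compl_compl]

theorem transitionStar_dual_compl (p : Fin 4 → ℝ) (a b : State N × Fin N) :
    transitionStar N (dual p) (compl a.1, a.2) (compl b.1, b.2) = transitionStar N p a b := by
  simp only [transitionStar, changeProb_dual_compl, keepProb_dual_compl, flip_compl,
    EmbeddingLike.apply_eq_iff_eq]

/-- Complementing the statuses of a chain for `dual p`, with the players kept, gives a chain for `p`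
on the same space with opposite payoffs. -/
theorem IsMeanProfit.dual {p : Fin 4 → ℝ} {m : ℝ} (h : IsMeanProfit N p m) :
    IsMeanProfit N (dual p) (-m) := by
  intro Ω _ ℙ _ Z hZ
  have hcc : ∀ a : State N × Fin N, (compl (compl a.1), a.2) = a := fun a => by
    rw [compl_compl]
  have hiff : ∀ a b : State N × Fin N, (compl a.1, a.2) = b ↔ a = (compl b.1, b.2) := fun a b =>
    ⟨fun h => by rw [← h, hcc], fun h => by rw [h, hcc]⟩
  have hchain : IsGameChain N p ℙ fun n ω => (compl (Z n ω).1, (Z n ω).2) :=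
    { measurable := fun n => (measurable_of_finite
        fun a : State N × Fin N => (compl a.1, a.2)).comp (hZ.measurable n)
      markov := fun n a => by
        simp only [hiff]
        rw [hZ.markov n fun k => (compl (a k).1, (a k).2), transitionStar_dual_compl] }
  have hpay : ∀ a b : State N × Fin N,
      payoff (compl a.1, a.2) (compl b.1, b.2) = -payoff a b := fun a b => by
    simp only [payoff, compl_apply, one_sub_eq_one_iff, ite_not]
    split_ifs <;> simp
  filter_upwards [h Ω ℙ _ hchain] with ω hω
  refine hω.neg.congr fun n => ?_
  simp only [cumProfit, hpay, Finset.sum_neg_distrib, neg_div, neg_neg]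

theorem sum_mem_Icc_of_mem_stdSimplex {S : Type*} [Fintype S] {π f : S → ℝ}
    (hπ : π ∈ stdSimplex ℝ S) {c C : ℝ} (h : ∀ x, f x ∈ Set.Icc c C) :
    π ⬝ᵥ f ∈ Set.Icc c C :=
  (convex_Icc c C).sum_mem (fun x _ => hπ.1 x) hπ.2 fun x _ => h x

end Model

end CoopParrondo

theorem mainTheorem8 (N : ℕ) [NeZero N] (hN : 3 ≤ N) (p : Fin 4 → ℝ)
    (hp : ∀ m, p m ∈ Set.Icc (0 : ℝ) 1)
    (herg : CoopParrondo.IsErgodic (CoopParrondo.transition N p)) :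
    -- the mean parameter is well defined: the strong law of large numbers holds with it
    CoopParrondo.IsMeanProfit N p (CoopParrondo.meanProfit N p) ∧
    -- (a)
    (CoopParrondo.IsErgodic (CoopParrondo.transition N (CoopParrondo.dual p)) ∧
      CoopParrondo.IsMeanProfit N (CoopParrondo.dual p)
        (CoopParrondo.meanProfit N (CoopParrondo.dual p)) ∧
      CoopParrondo.meanProfit N p = -CoopParrondo.meanProfit N (CoopParrondo.dual p) ∧
      (p 0 + p 3 = 1 → p 1 + p 2 = 1 → CoopParrondo.meanProfit N p = 0)) ∧
    -- (b)
    (2 * min (min (p 0) (p 1)) (min (p 2) (p 3)) - 1 ≤ CoopParrondo.meanProfit N p ∧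
      CoopParrondo.meanProfit N p ≤ 2 * max (max (p 0) (p 1)) (max (p 2) (p 3)) - 1) := by
  obtain ⟨π, hπ, hm⟩ := herg.exists_isMeanProfit
  have hN0 : (N : ℝ) ≠ 0 := Nat.cast_ne_zero.2 (NeZero.ne N)
  have hdual : ∀ m, CoopParrondo.dual p m ∈ Set.Icc (0 : ℝ) 1 := fun m => by
    have h : ∀ k, 1 - p k ∈ Set.Icc (0 : ℝ) 1 := fun k =>
      ⟨sub_nonneg.2 (hp k).2, sub_le_self _ (hp k).1⟩
    fin_cases m <;> exact h _
  have hneg : CoopParrondo.meanProfit N p = -CoopParrondo.meanProfit N (CoopParrondo.dual p) := by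
    rw [hm.dual.meanProfit.unique hdual hm.meanProfit.dual, neg_neg]
  have hbounds : CoopParrondo.meanProfit N p ∈ Set.Icc
      (2 * min (min (p 0) (p 1)) (min (p 2) (p 3)) - 1)
      (2 * max (max (p 0) (p 1)) (max (p 2) (p 3)) - 1) := by
    rw [hm.meanProfit.unique hp hm]
    refine CoopParrondo.sum_mem_Icc_of_mem_stdSimplex hπ fun x => ?_
    rw [Finset.mul_sum]
    -- The mean is a convex combination twice over: `π` over the states, then uniform weights over
    -- the players.
    refine (convex_Icc _ _).sum_mem (w := fun _ : Fin N => (N : ℝ)⁻¹)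
      (fun _ _ => by positivity) (by simp [hN0]) fun i _ => ?_
    have h : ∀ k : Fin 4, min (min (p 0) (p 1)) (min (p 2) (p 3)) ≤ p k ∧
        p k ≤ max (max (p 0) (p 1)) (max (p 2) (p 3)) := fun k => by
      fin_cases k <;> simp
    have h1 := h (CoopParrondo.nbr x i)
    exact ⟨by linarith [h1.1], by linarith [h1.2]⟩
  refine ⟨hm.meanProfit, ⟨?_, hm.dual.meanProfit, hneg, fun h03 h12 => ?_⟩, hbounds⟩
  · rw [CoopParrondo.transition_dual]
    exact herg.submatrix _
  · have hpd : CoopParrondo.dual p = p := by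
      funext m
      fin_cases m <;> simp [CoopParrondo.dual] <;> linarith
    rw [hpd] at hneg
    linarith
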